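/- Let $R_y(\theta)=\begin{pmatrix}\cos\frac\theta2&-\sin\frac\theta2\\ \sin\frac\theta2&\cos\frac\theta2\end{pmatrix}$ and let $\sigma_y$ and $X$ be the usual Pauli matrices. Consider the following two-party protocol (Scheme 2). Alice holds $n$ data qubits and one phase qubit, and she shares with Bob $m$ EPR pairs $\frac1{\sqrt2}(|00\rangle+|11\rangle)$. The input states are the rebit encodings $\sum_x(\mathrm{Re}\,\varphi_x)\,|x\rangle|0\rangle+(\mathrm{Im}\,\varphi_x)\,|x\rangle|1\rangle$ (the last qubit is the phase qubit) of the $n$-qubit pure states $\sum_x\varphi_x|x\rangle$, that is, all real states of the $n+1$ qubits, and probabilistic mixtures of such states. Following a publicly known circuit, Alice performs a finite sequence of steps of two kinds: (a) a controlled-$R_y(j\pi)$ gate, $j\in\{1,3\}$, with some data qubit as the control and the phase qubit as the target; (b) a gate gadget on some data qubit, in which she takes a fresh EPR pair, applies a controlled-$i\sigma_y$ gate with her half of the pair as the control and the data qubit as the target, then applies $R_y(\frac\pi2)$ to her half, and measures it in the $Z$ basis. Each of the $m$ EPR pairs is used in exactly one gadget. Alice sends all measurement outcomes to Bob. Bob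 then holds this message and his halves of the EPR pairs, and he may process and measure them in any way. Two inputs are said to be not distinguishable by Bob at all if every measurement on what he holds has the same outcome distribution for both inputs. For every such circuit the following hold. (i) Suppose that two input states are each a product state across the bipartition between the $n$ data qubits and the phase qubit, and that they are related to each other by $R_y(\pi)$ on each data qubit and $R_y(\theta)$ on the phase qubit, where $\theta$ is any real number. Then Bob cannot distinguish these two input states at all. (ii) Suppose that $n$ is odd, and let $s\in\{0,1\}^n$ be a fixed bit string. Encode a logical qubit by $|0\rangle\mapsto|s\rangle$ and $|1\rangle\mapsto X^{\otimes n}|s\rangle$ on the data qubits (in particular, for $s=0\dots0$, by $|0\rangle^{\otimes n}$ and $|1\rangle^{\otimes n}$), and use the rebit encoding of $\alpha|s\rangle+\beta X^{\otimes n}|s\rangle$, $\alpha,\beta\in\mathbb C$, $|\alpha|^2+|\beta|^2=1$, as the input state. This logical qubit is perfectly secure: Bob cannot distinguish any two of these input states, or mixtures of them, at all. -/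

import Mathlib

open scoped Matrix Kronecker ComplexOrder

noncomputable section

namespace RebitQHE

/-! ### One-qubit matrices -/

/-- The rotation `R_y(θ)` of the Bloch sphere. -/
def Ry (θ : ℝ) : Matrix (Fin 2) (Fin 2) ℂ :=
  !![(Real.cos (θ / 2) : ℂ), -(Real.sin (θ / 2) : ℂ);
     (Real.sin (θ / 2) : ℂ), (Real.cos (θ / 2) : ℂ)]

/-- The Pauli matrix `σ_y`. -/
def sigmaY : Matrix (Fin 2) (Fin 2) ℂ := !![0, -Complex.I; Complex.I, 0]

/-! ### The qubits of the protocol -/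

/-- The qubits present in a run with `n` data qubits and `m` EPR pairs. The data qubits, the phase
qubit and the halves `alice e` of the EPR pairs are held by Alice, the halves `bob e` by Bob. -/
inductive Wire (n m : ℕ) : Type
  | data (i : Fin n)
  | phase
  | alice (e : Fin m)
  | bob (e : Fin m)
  deriving DecidableEq, Fintype

/-- Labels of the computational basis of all qubits together. -/
abbrev Reg (n m : ℕ) : Type := Wire n m → Fin 2

/-- Labels of the computational basis of Alice's input: the data qubits and the phase qubit. -/
abbrev InReg (n : ℕ) : Type := (Fin n → Fin 2) × Fin 2

/-- Labels of what Bob holds in the end: Alice's message (one outcome bit for every EPR pair),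
and Bob's halves of the EPR pairs. -/
abbrev BobReg (m : ℕ) : Type := (Fin m → Fin 2) × (Fin m → Fin 2)

/-- The basis label of all the qubits, from the labels of its parts. -/
def assemble {n m : ℕ} (d : Fin n → Fin 2) (p : Fin 2) (a b : Fin m → Fin 2) : Reg n m
  | .data i => d i
  | .phase => p
  | .alice e => a e
  | .bob e => b e

/-- The one-qubit gate `U` on the qubit `q` (identity on all other qubits). -/
def onWire {n m : ℕ} (U : Matrix (Fin 2) (Fin 2) ℂ) (q : Wire n m) :
    Matrix (Reg n m) (Reg n m) ℂ :=
  Matrix.of fun x y => if ∀ r, r ≠ q → x r = y r then U (x q) (y q) else 0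

/-- The controlled-`U` gate with control qubit `c` and target qubit `t ≠ c`. -/
def controlled {n m : ℕ} (U : Matrix (Fin 2) (Fin 2) ℂ) (c t : Wire n m) :
    Matrix (Reg n m) (Reg n m) ℂ :=
  Matrix.of fun x y => if x c = 1 then onWire U t x y else (1 : Matrix _ _ ℂ) x y

/-! ### Alice's circuit -/

/-- The steps of Alice's circuit. -/
inductive Step (n m : ℕ) : Type
  /-- A gate gadget on the data qubit `i`, which uses the EPR pair `e`. -/
  | gadget (i : Fin n) (e : Fin m)
  /-- The controlled-`R_y(jπ)`, `j = 1, 3`, from the data qubit `i` to the phase qubit; it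
  implements the logical gate `R_z(jπ/2)` on qubit `i`. -/
  | ctrlRy (i : Fin n) (j : ℕ) (hj : j = 1 ∨ j = 3)

/-- The EPR pair used by a step, if any. -/
def Step.pair? {n m : ℕ} : Step n m → Option (Fin m)
  | .gadget _ e => some e
  | .ctrlRy _ _ _ => none

/-- What Alice does in a step. In a gadget: controlled-`iσ_y` from her half of the EPR pair to the
data qubit, then `R_y(π/2)` on her half, which is then ready for the measurement in the `Z` basis
and is never touched again. -/
def Step.op {n m : ℕ} : Step n m → Matrix (Reg n m) (Reg n m) ℂ
  | .gadget i e =>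
      onWire (Ry (Real.pi / 2)) (.alice e) *
        controlled (Complex.I • sigmaY) (.alice e) (.data i)
  | .ctrlRy i j _ => controlled (Ry (j * Real.pi)) (.data i) .phase

/-- The part of the circuit known to both parties: a finite sequence of gate gadgets on data
qubits, interspersed with controlled-`R_y(jπ)` gates between data qubits and the phase qubit, every
gadget using an EPR pair of its own. A real `Y`-diagonal unitary on all data qubits contributes one
gadget on each data qubit; its details enter in Bob's later processing only. -/
structure Circuit (n m : ℕ) : Type where
  /-- the steps, the first one first -/
  steps : List (Step n m)
  /-- each EPR pair is used in exactly one gadget -/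
  once : ∀ e : Fin m, (steps.filterMap Step.pair?).count e = 1

/-- The unitary of a list of steps, performed from left to right. -/
def stepsOp {n m : ℕ} : List (Step n m) → Matrix (Reg n m) (Reg n m) ℂ
  | [] => 1
  | s :: l => stepsOp l * s.op

/-! ### The state of Bob -/

/-- The amplitudes of an EPR pair `(|00⟩ + |11⟩)/√2`. -/
def epr (a b : Fin 2) : ℂ := if a = b then ((Real.sqrt 2)⁻¹ : ℝ) else 0

/-- The initial state of all qubits: the input state `ρ`, and `m` EPR pairs. -/
def initialState {n : ℕ} (m : ℕ) (ρ : Matrix (InReg n) (InReg n) ℂ) :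
    Matrix (Reg n m) (Reg n m) ℂ :=
  Matrix.of fun x y =>
    ρ (fun i => x (.data i), x .phase) (fun i => y (.data i), y .phase) *
      ∏ e : Fin m, epr (x (.alice e)) (x (.bob e)) * star (epr (y (.alice e)) (y (.bob e)))

/-- The state of all qubits after Alice's gates, before her measurements. -/
def finalState {n m : ℕ} (c : Circuit n m) (ρ : Matrix (InReg n) (InReg n) ℂ) :
    Matrix (Reg n m) (Reg n m) ℂ :=
  stepsOp c.steps * initialState m ρ * (stepsOp c.steps)ᴴ

/-- Bob's state after Alice has measured her halves of the EPR pairs in the `Z` basis and has sent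
him all outcomes: a density matrix on the (classical, hence block diagonal) message and Bob's
halves of the EPR pairs, the data qubits and the phase qubit being traced out. -/
def bobState {n m : ℕ} (c : Circuit n m) (ρ : Matrix (InReg n) (InReg n) ℂ) :
    Matrix (BobReg m) (BobReg m) ℂ :=
  Matrix.of fun v w =>
    if v.1 = w.1 then
      ∑ d : Fin n → Fin 2, ∑ p : Fin 2,
        finalState c ρ (assemble d p v.1 v.2) (assemble d p w.1 w.2)
    else 0

/-- A quantum measurement (POVM) with `k` outcomes. -/
def IsPOVM {ι : Type} [Fintype ι] [DecidableEq ι] {k : ℕ} (E : Fin k → Matrix ι ι ℂ) : Prop :=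
  (∀ o, (E o).PosSemidef) ∧ ∑ o, E o = 1

/-- Bob cannot distinguish the inputs `ρ₁` and `ρ₂` at all: whatever measurement he makes on
everything that he holds and has received, its outcome has the same distribution for both. -/
def BobCannotDistinguish {n m : ℕ} (c : Circuit n m) (ρ₁ ρ₂ : Matrix (InReg n) (InReg n) ℂ) :
    Prop :=
  ∀ (k : ℕ) (E : Fin k → Matrix (BobReg m) (BobReg m) ℂ), IsPOVM E →
    ∀ o, (E o * bobState c ρ₁).trace = (E o * bobState c ρ₂).trace

/-! ### Input states -/

/-- The density matrix of a pure state. -/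
def pureState {ι : Type} (ψ : ι → ℂ) : Matrix ι ι ℂ := Matrix.vecMulVec ψ (star ψ)

/-- Density matrices. -/
def IsDensity {ι : Type} [Fintype ι] (ρ : Matrix ι ι ℂ) : Prop :=
  ρ.PosSemidef ∧ ρ.trace = 1

/-- The rebit encoding `∑ (aₓ + i bₓ)|x⟩ ↦ ∑ (aₓ |x⟩|R⟩ + bₓ |x⟩|I⟩)`, where `|R⟩ = |0⟩` and
`|I⟩ = |1⟩` are states of the phase qubit. -/
def rebitEncode {n : ℕ} (φ : (Fin n → Fin 2) → ℂ) : InReg n → ℂ :=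
  fun x => if x.2 = 0 then ((φ x.1).re : ℂ) else ((φ x.1).im : ℂ)

/-- The allowed input states: states of `n` qubits in the rebit encoding, and mixtures of them. As
the encodings are all the real unit vectors, these are the real states of the data qubits and the
phase qubit. -/
def inputStates (n : ℕ) : Set (Matrix (InReg n) (InReg n) ℂ) :=
  convexHull ℝ {ρ | ∃ φ : (Fin n → Fin 2) → ℂ,
    ∑ x, ‖φ x‖ ^ 2 = 1 ∧ ρ = pureState (rebitEncode φ)}

/-- Product states across the cut between the data qubits and the phase qubit. -/
def IsProductState {n : ℕ} (ρ : Matrix (InReg n) (InReg n) ℂ) : Prop :=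
  ∃ (σ : Matrix (Fin n → Fin 2) (Fin n → Fin 2) ℂ) (τ : Matrix (Fin 2) (Fin 2) ℂ),
    IsDensity σ ∧ IsDensity τ ∧ ρ = σ ⊗ₖ τ

/-- The operator `R_y(π)` on each data qubit and `R_y(θ)` on the phase qubit. -/
def mask (n : ℕ) (θ : ℝ) : Matrix (InReg n) (InReg n) ℂ :=
  Matrix.of fun x y => (∏ i, Ry Real.pi (x.1 i) (y.1 i)) * Ry θ x.2 y.2

/-- The `n`-qubit state `α|s⟩ + β X^{⊗n}|s⟩`. -/
def logicalKet {n : ℕ} (s : Fin n → Fin 2) (α β : ℂ) : (Fin n → Fin 2) → ℂ :=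
  Pi.single s α + Pi.single (fun i => s i + 1) β

/-- The states of the logical qubit with `|0⟩ ↦ |s⟩`, `|1⟩ ↦ X^{⊗n}|s⟩`, together with the phase
qubit: the rebit encodings of `α|s⟩ + β X^{⊗n}|s⟩`, and mixtures of them. -/
def logicalStates {n : ℕ} (s : Fin n → Fin 2) : Set (Matrix (InReg n) (InReg n) ℂ) :=
  convexHull ℝ {ρ | ∃ α β : ℂ,
    ‖α‖ ^ 2 + ‖β‖ ^ 2 = 1 ∧ ρ = pureState (rebitEncode (logicalKet s α β))}

end RebitQHE

end

/-!
Bob's state is a linear function of the input state, and it is blind to two symmetries of the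
circuit. The rotations `R_y(θ)` of the phase qubit commute with every step, so they act only on
qubits that Bob never sees (`bobState_rotate_phase`). The operator `T = R_y(π)^{⊗n} ⊗ σ_z` commutes
with the gadgets, and moving it past a controlled-`R_y` only costs a rotation of the phase qubit,
because `R_y(π)` exchanges the two values of the control while `σ_z` inverts the rotation of the
target (`exists_stepsOp_flip`). In terms of complex amplitudes `T` is the antiunitary spin flip of
all data qubits, and the symmetry says that, conditionally on the values of the EPR pairs, the
circuit acts by elements of `SU(2)` up to phases.

Averaging over the rotations of the phase qubit leaves only the trace and the antisymmetric part
of its factor (`bobState_congr_phase`). With the second symmetry, Bob's state is the same for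
`σ ⊗ M` and for `(R_y(π)^{⊗n} σ R_y(π)^{⊗n}ᴴ) ⊗ Mᵀ` (`bobState_flip`).

For a real product state `σ ⊗ τ` the factor `τ` is symmetric, so this is the first part.
In the rebit encoding of `α|s⟩ + β X^{⊗n}|s⟩`, the diagonal terms contribute `|α|²` and `|β|²` times
one and the same state. The two cross terms are related by the spin flip up to the sign `(-1)^n`,
the sign of the square of the spin flip (Kramers degeneracy); so they cancel for odd `n`, and
nothing of `α` and `β` is left (`bobState_logical`).
-/

noncomputable section

namespace RebitQHE

/-! ### Tensor products of one-qubit operators -/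

/-- The tensor product of one-qubit operators `U r`, one on each of the qubits `r : ι`. -/
def tens {ι : Type} [Fintype ι] (U : ι → Matrix (Fin 2) (Fin 2) ℂ) :
    Matrix (ι → Fin 2) (ι → Fin 2) ℂ :=
  Matrix.of fun x y => ∏ r, U r (x r) (y r)

lemma tens_apply {ι : Type} [Fintype ι] (U : ι → Matrix (Fin 2) (Fin 2) ℂ) (x y : ι → Fin 2) :
    tens U x y = ∏ r, U r (x r) (y r) := rfl

lemma tens_mul {ι : Type} [Fintype ι] [DecidableEq ι] (U V : ι → Matrix (Fin 2) (Fin 2) ℂ) :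
    tens U * tens V = tens (U * V) := by
  ext x y
  simp only [Matrix.mul_apply, tens_apply, Pi.mul_apply, ← Finset.prod_mul_distrib]
  rw [Finset.prod_univ_sum, Fintype.piFinset_univ]

lemma tens_one {ι : Type} [Fintype ι] [DecidableEq ι] :
    tens (1 : ι → Matrix (Fin 2) (Fin 2) ℂ) = 1 := by
  ext x y
  simp only [tens_apply, Pi.one_apply, Matrix.one_apply, funext_iff]
  simp [Finset.prod_ite_zero]

lemma conjTranspose_tens {ι : Type} [Fintype ι] (U : ι → Matrix (Fin 2) (Fin 2) ℂ) :
    (tens U)ᴴ = tens fun r => (U r)ᴴ := by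
  ext x y
  simp [Matrix.conjTranspose_apply, tens_apply]

lemma tens_commute {ι : Type} [Fintype ι] [DecidableEq ι]
    {U V : ι → Matrix (Fin 2) (Fin 2) ℂ} (h : ∀ r, Commute (U r) (V r)) :
    Commute (tens U) (tens V) := by
  rw [Commute, SemiconjBy, tens_mul, tens_mul]
  exact congrArg tens (funext h)

lemma onWire_eq_tens {n m : ℕ} (U : Matrix (Fin 2) (Fin 2) ℂ) (q : Wire n m) :
    onWire U q = tens (Function.update 1 q U) := by
  ext x y
  rw [tens_apply, ← Finset.mul_prod_erase _ _ (Finset.mem_univ q), Function.update_self]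
  have h : ∏ r ∈ Finset.univ.erase q,
      Function.update (1 : Wire n m → Matrix (Fin 2) (Fin 2) ℂ) q U r (x r) (y r) =
      ∏ r ∈ Finset.univ.erase q, if x r = y r then 1 else 0 := by
    refine Finset.prod_congr rfl fun r hr => ?_
    rw [Function.update_of_ne (Finset.ne_of_mem_erase hr), Pi.one_apply, Matrix.one_apply]
  rw [h, Finset.prod_ite_zero]
  simp [onWire]

/-- The controlled gate as the sum of its two branches: the control qubit is projected on `|0⟩`,
or it is projected on `|1⟩` and the gate is applied. -/
lemma controlled_eq_tens {n m : ℕ} (U : Matrix (Fin 2) (Fin 2) ℂ) {c t : Wire n m} (h : c ≠ t) :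
    controlled U c t = tens (Function.update 1 c !![1, 0; 0, 0]) +
      tens (Function.update (Function.update 1 t U) c !![0, 0; 0, 1]) := by
  have h1 : Function.update (Function.update (1 : Wire n m → Matrix (Fin 2) (Fin 2) ℂ) t U) c
      !![0, 0; 0, 1] =
        (Function.update 1 c !![0, 0; 0, 1] : Wire n m → Matrix (Fin 2) (Fin 2) ℂ) *
          (Function.update 1 t U : Wire n m → Matrix (Fin 2) (Fin 2) ℂ) := by
    funext r
    by_cases hc : r = c
    · subst hc; simp [h]
    · simp [hc]
  rw [h1, ← tens_mul, ← onWire_eq_tens, ← onWire_eq_tens, ← onWire_eq_tens]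
  ext x y
  rw [Matrix.add_apply, Matrix.mul_apply, Finset.sum_eq_single x]
  · have hxy : (∀ r, r ≠ c → x r = y r) → x c = y c → x = y := fun h1 h2 => by
      funext r
      by_cases hr : r = c
      · rw [hr, h2]
      · exact h1 r hr
    have hne : x c ≠ y c → x ≠ y := fun h1 h2 => h1 (h2 ▸ rfl)
    by_cases hx : ∀ r, r ≠ c → x r = y r
    · by_cases hc : x c = y c
      · obtain rfl := hxy hx hc
        rcases Fin.exists_fin_two.mp ⟨x c, rfl⟩ with h0 | h0 <;> simp [controlled, onWire, h0]
      · have hw : onWire U t x y = 0 := by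
          simp only [onWire, Matrix.of_apply]
          exact if_neg fun h' => hc (h' c h)
        have h0 : (1 : Matrix (Reg n m) (Reg n m) ℂ) x y = 0 := Matrix.one_apply_ne (hne hc)
        simp only [controlled, Matrix.of_apply, hw, h0]
        simp only [onWire, Matrix.of_apply, if_pos hx]
        generalize x c = a at *
        generalize y c = b at *
        fin_cases a <;> fin_cases b <;> simp_all
    · have h0 : (1 : Matrix (Reg n m) (Reg n m) ℂ) x y = 0 :=
        Matrix.one_apply_ne fun h' => hx fun r _ => h' ▸ rfl
      simp only [controlled, Matrix.of_apply, h0]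
      rcases Fin.exists_fin_two.mp ⟨x c, rfl⟩ with h0 | h0 <;> simp [onWire, h0, hx]
  · intro z _ hz
    have : onWire !![0, 0; 0, 1] c x z = 0 := by
      simp only [onWire, Matrix.of_apply]
      split_ifs with h1
      · have hc : x c ≠ z c := fun h2 => hz <| by
          funext r
          by_cases hr : r = c
          · rw [hr, h2]
          · exact (h1 r hr).symm
        generalize x c = a at *
        generalize z c = b at *
        fin_cases a <;> fin_cases b <;> simp_all
      · rfl
    rw [this, zero_mul]
  · simp

/-! ### Operators on Alice's input and Bob's reduced state -/

/-- The labels of all qubits, split into those of Alice's input and those that become Bob's. -/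
def splitReg (n m : ℕ) : Reg n m ≃ InReg n × BobReg m where
  toFun x := ((fun i => x (.data i), x .phase), (fun e => x (.alice e), fun e => x (.bob e)))
  invFun z := assemble z.1.1 z.1.2 z.2.1 z.2.2
  left_inv x := by funext r; cases r <;> rfl
  right_inv z := rfl

/-- The operator `K` on the data qubits and the phase qubit, and the operator `E` on the EPR
pairs, as an operator on all qubits. -/
def joint {n m : ℕ} (K : Matrix (InReg n) (InReg n) ℂ) (E : Matrix (BobReg m) (BobReg m) ℂ) :
    Matrix (Reg n m) (Reg n m) ℂ :=
  (K ⊗ₖ E).submatrix (splitReg n m) (splitReg n m)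

lemma joint_mul {n m : ℕ} (K L : Matrix (InReg n) (InReg n) ℂ)
    (E F : Matrix (BobReg m) (BobReg m) ℂ) :
    joint K E * joint L F = joint (K * L) (E * F) := by
  rw [joint, joint, joint, Matrix.submatrix_mul_equiv, Matrix.mul_kronecker_mul]

lemma conjTranspose_joint {n m : ℕ} (K : Matrix (InReg n) (InReg n) ℂ)
    (E : Matrix (BobReg m) (BobReg m) ℂ) : (joint K E)ᴴ = joint Kᴴ Eᴴ := by
  rw [joint, joint, Matrix.conjTranspose_submatrix, Matrix.conjTranspose_kronecker]

/-- The one-qubit operators `A` on each data qubit and `B` on the phase qubit. -/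
def inputOps {n m : ℕ} (A B : Matrix (Fin 2) (Fin 2) ℂ) : Wire n m → Matrix (Fin 2) (Fin 2) ℂ
  | .data _ => A
  | .phase => B
  | .alice _ => 1
  | .bob _ => 1

/-- The operator `A` on each data qubit and `B` on the phase qubit. -/
def inputOp (n : ℕ) (A B : Matrix (Fin 2) (Fin 2) ℂ) : Matrix (InReg n) (InReg n) ℂ :=
  tens (fun _ : Fin n => A) ⊗ₖ B

lemma inputOp_mul {n : ℕ} (A B A' B' : Matrix (Fin 2) (Fin 2) ℂ) :
    inputOp n A B * inputOp n A' B' = inputOp n (A * A') (B * B') := by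
  rw [inputOp, inputOp, ← Matrix.mul_kronecker_mul, tens_mul]
  rfl

lemma conjTranspose_inputOp {n : ℕ} (A B : Matrix (Fin 2) (Fin 2) ℂ) :
    (inputOp n A B)ᴴ = inputOp n Aᴴ Bᴴ := by
  rw [inputOp, Matrix.conjTranspose_kronecker, conjTranspose_tens]
  rfl

lemma inputOp_one {n : ℕ} : inputOp n 1 1 = 1 := by
  rw [inputOp, ← Matrix.one_kronecker_one]
  exact congrArg (· ⊗ₖ _) tens_one

/-- The qubits as a disjoint union. -/
def wireEquiv (n m : ℕ) : (Fin n ⊕ Unit) ⊕ (Fin m ⊕ Fin m) ≃ Wire n m where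
  toFun := Sum.elim (Sum.elim .data fun _ => .phase) (Sum.elim .alice .bob)
  invFun
    | .data i => .inl (.inl i)
    | .phase => .inl (.inr ())
    | .alice e => .inr (.inl e)
    | .bob e => .inr (.inr e)
  left_inv x := by rcases x with (_ | _) | (_ | _) <;> rfl
  right_inv x := by cases x <;> rfl

lemma prod_wire {n m : ℕ} (f : Wire n m → ℂ) :
    ∏ r, f r = ((∏ i, f (.data i)) * f .phase) * ((∏ e, f (.alice e)) * ∏ e, f (.bob e)) := by
  rw [← (wireEquiv n m).prod_comp]
  simp [wireEquiv]

lemma joint_inputOp {n m : ℕ} (A B : Matrix (Fin 2) (Fin 2) ℂ) :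
    joint (m := m) (inputOp n A B) 1 = tens (inputOps A B) := by
  ext x y
  have h : (1 : Matrix (BobReg m) (BobReg m) ℂ) = 1 ⊗ₖ 1 := Matrix.one_kronecker_one.symm
  rw [h, ← tens_one, tens_apply, prod_wire]
  rfl

lemma initialState_eq_joint {n : ℕ} (m : ℕ) (ρ : Matrix (InReg n) (InReg n) ℂ) :
    initialState m ρ = joint ρ (Matrix.of fun v w : BobReg m =>
      ∏ e, epr (v.1 e) (v.2 e) * star (epr (w.1 e) (w.2 e))) := rfl

lemma initialState_conj {n : ℕ} (m : ℕ) (K ρ : Matrix (InReg n) (InReg n) ℂ) :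
    initialState m (K * ρ * Kᴴ) = joint K 1 * initialState m ρ * (joint K 1)ᴴ := by
  simp only [initialState_eq_joint, conjTranspose_joint, joint_mul, one_mul, mul_one,
    Matrix.conjTranspose_one]

/-- The reduced state of the EPR pairs, the input register being traced out. -/
def traceInput {n m : ℕ} (F : Matrix (Reg n m) (Reg n m) ℂ) : Matrix (BobReg m) (BobReg m) ℂ :=
  Matrix.of fun v w => Matrix.trace (Matrix.of fun i j =>
    F ((splitReg n m).symm (i, v)) ((splitReg n m).symm (j, w)))

lemma bobState_apply {n m : ℕ} (c : Circuit n m) (ρ : Matrix (InReg n) (InReg n) ℂ)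
    (v w : BobReg m) :
    bobState c ρ v w = if v.1 = w.1 then traceInput (finalState c ρ) v w else 0 := by
  simp only [bobState, traceInput, Matrix.trace, Matrix.of_apply, Matrix.diag_apply,
    Fintype.sum_prod_type]
  rfl

/-- An isometry on the register that is traced out does not change the reduced state. -/
lemma traceInput_conj {n m : ℕ} {L : Matrix (InReg n) (InReg n) ℂ} (hL : Lᴴ * L = 1)
    (F : Matrix (Reg n m) (Reg n m) ℂ) :
    traceInput (joint L 1 * F * (joint L 1)ᴴ) = traceInput F := by
  ext v w
  simp only [traceInput, Matrix.of_apply]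
  have h : (Matrix.of fun i j => (joint L 1 * F * (joint L 1)ᴴ : Matrix (Reg n m) (Reg n m) ℂ)
      ((splitReg n m).symm (i, v)) ((splitReg n m).symm (j, w))) =
      L * (Matrix.of fun i j => F ((splitReg n m).symm (i, v)) ((splitReg n m).symm (j, w))) *
        Lᴴ := by
    ext i j
    rw [conjTranspose_joint]
    simp only [Matrix.mul_apply, Matrix.of_apply, ← (splitReg n m).symm.sum_comp, joint,
      Matrix.submatrix_apply, Equiv.apply_symm_apply, Fintype.sum_prod_type (α₁ := InReg n),
      Matrix.kroneckerMap_apply, Matrix.conjTranspose_one, Matrix.one_apply]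
    simp
  rw [h, Matrix.trace_mul_comm, ← Matrix.mul_assoc, hL, Matrix.one_mul]

lemma bobState_conj {n m : ℕ} (c : Circuit n m) {K L : Matrix (InReg n) (InReg n) ℂ}
    (hL : Lᴴ * L = 1)
    (h : stepsOp c.steps * joint K 1 = joint L 1 * stepsOp c.steps)
    (ρ : Matrix (InReg n) (InReg n) ℂ) : bobState c (K * ρ * Kᴴ) = bobState c ρ := by
  have h2 : finalState c (K * ρ * Kᴴ) = joint L 1 * finalState c ρ * (joint L 1)ᴴ := by
    have h3 : (joint K 1)ᴴ * (stepsOp c.steps)ᴴ = (stepsOp c.steps)ᴴ * (joint L 1)ᴴ := by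
      rw [← Matrix.conjTranspose_mul, h, Matrix.conjTranspose_mul]
    calc finalState c (K * ρ * Kᴴ)
        = (stepsOp c.steps * joint K 1) * initialState m ρ *
            ((joint K 1)ᴴ * (stepsOp c.steps)ᴴ) := by
          rw [finalState, initialState_conj]; simp only [Matrix.mul_assoc]
      _ = joint L 1 * finalState c ρ * (joint L 1)ᴴ := by
          rw [h, h3, finalState]; simp only [Matrix.mul_assoc]
  ext v w
  rw [bobState_apply, bobState_apply, h2, traceInput_conj hL]

lemma bobState_add {n m : ℕ} (c : Circuit n m) (ρ ρ' : Matrix (InReg n) (InReg n) ℂ) :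
    bobState c (ρ + ρ') = bobState c ρ + bobState c ρ' := by
  have h : finalState c (ρ + ρ') = finalState c ρ + finalState c ρ' := by
    have : initialState m (ρ + ρ') = initialState m ρ + initialState m ρ' := by
      ext x y; simp [initialState, add_mul]
    rw [finalState, this, Matrix.mul_add, Matrix.add_mul]; rfl
  ext v w
  by_cases hvw : v.1 = w.1 <;> simp [bobState, h, hvw, Finset.sum_add_distrib]

lemma bobState_smul {n m : ℕ} (c : Circuit n m) (a : ℂ) (ρ : Matrix (InReg n) (InReg n) ℂ) :
    bobState c (a • ρ) = a • bobState c ρ := by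
  have h : finalState c (a • ρ) = a • finalState c ρ := by
    have : initialState m (a • ρ) = a • initialState m ρ := by
      ext x y; simp [initialState, mul_assoc]
    rw [finalState, this, Matrix.mul_smul, Matrix.smul_mul]; rfl
  ext v w
  by_cases hvw : v.1 = w.1 <;> simp [bobState, h, hvw, Finset.mul_sum, mul_add]

lemma bobState_neg {n m : ℕ} (c : Circuit n m) (ρ : Matrix (InReg n) (InReg n) ℂ) :
    bobState c (-ρ) = -bobState c ρ := by
  rw [← neg_one_smul ℂ ρ, bobState_smul, neg_one_smul]

/-! ### The symmetries of the circuit -/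

/-- The Pauli matrix `σ_z`. -/
def sigmaZ : Matrix (Fin 2) (Fin 2) ℂ := !![1, 0; 0, -1]

lemma Ry_zero : Ry 0 = 1 := by
  ext i j; fin_cases i <;> fin_cases j <;> simp [Ry]

lemma Ry_add (a b : ℝ) : Ry (a + b) = Ry a * Ry b := by
  rw [Ry, add_div, Real.cos_add, Real.sin_add]
  ext i j
  fin_cases i <;> fin_cases j <;> simp [Ry, Matrix.mul_apply] <;> ring

lemma Ry_pi : Ry Real.pi = !![0, -1; 1, 0] := by
  simp [Ry]

lemma conjTranspose_Ry (a : ℝ) : (Ry a)ᴴ = Ry (-a) := by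
  ext i j
  fin_cases i <;> fin_cases j <;> simp [Ry, Matrix.conjTranspose_apply, neg_div,
    -Complex.ofReal_cos, -Complex.ofReal_sin]

lemma Ry_commute (a b : ℝ) : Commute (Ry a) (Ry b) := by
  rw [Commute, SemiconjBy, ← Ry_add, ← Ry_add, add_comm]

lemma conjTranspose_Ry_mul_self (a : ℝ) : (Ry a)ᴴ * Ry a = 1 := by
  rw [conjTranspose_Ry, ← Ry_add, neg_add_cancel, Ry_zero]

lemma Ry_pi_conj (M : Matrix (Fin 2) (Fin 2) ℂ) :
    Ry Real.pi * M * (Ry Real.pi)ᴴ = !![M 1 1, -M 1 0; -M 0 1, M 0 0] := by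
  rw [Ry_pi]
  nth_rewrite 1 [Matrix.eta_fin_two M]
  ext i j
  fin_cases i <;> fin_cases j <;> simp [Matrix.mul_apply]

lemma sigmaZ_conj (M : Matrix (Fin 2) (Fin 2) ℂ) :
    sigmaZ * M * sigmaZᴴ = !![M 0 0, -M 0 1; -M 1 0, M 1 1] := by
  nth_rewrite 1 [Matrix.eta_fin_two M]
  ext i j
  fin_cases i <;> fin_cases j <;> simp [Matrix.mul_apply, sigmaZ]

lemma sigmaZ_mul_Ry (a : ℝ) : sigmaZ * Ry a = Ry (-a) * sigmaZ := by
  ext i j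
  fin_cases i <;> fin_cases j <;> simp [Ry, sigmaZ, Matrix.mul_apply, neg_div]

lemma I_smul_sigmaY : Complex.I • sigmaY = Ry (-Real.pi) := by
  ext i j
  fin_cases i <;> fin_cases j <;> simp [Ry, sigmaY, neg_div]

/-- The rotations of the phase qubit commute with every step. -/
lemma stepOp_commute_phase {n m : ℕ} (s : Step n m) (θ : ℝ) :
    Commute (tens (inputOps 1 (Ry θ))) s.op := by
  cases s with
  | gadget i e =>
    rw [Step.op, onWire_eq_tens, controlled_eq_tens _ (by simp)]
    refine .mul_right (tens_commute fun r => ?_)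
      (.add_right (tens_commute fun r => ?_) (tens_commute fun r => ?_)) <;>
    cases r <;> simp [inputOps]
  | ctrlRy i j hj =>
    rw [Step.op, controlled_eq_tens _ (by simp)]
    refine .add_right (tens_commute fun r => ?_) (tens_commute fun r => ?_) <;>
    cases r <;> simp [inputOps, Ry_commute]

/-- A step commutes with `R_y(π)^{⊗n} ⊗ σ_z` up to a rotation of the phase qubit. -/
lemma exists_stepOp_flip {n m : ℕ} (s : Step n m) :
    ∃ φ : ℝ, tens (inputOps (Ry Real.pi) sigmaZ) * s.op =
      tens (inputOps 1 (Ry φ)) * s.op * tens (inputOps (Ry Real.pi) sigmaZ) := by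
  cases s with
  | gadget i e =>
    refine ⟨0, ?_⟩
    have h1 : tens (inputOps (n := n) (m := m) 1 (Ry 0)) = 1 := by
      rw [← tens_one]
      congr 1
      funext r
      cases r <;> simp [inputOps, Ry_zero]
    rw [h1, one_mul, Step.op, onWire_eq_tens, controlled_eq_tens _ (by simp), I_smul_sigmaY]
    refine Commute.mul_right (tens_commute fun r => ?_)
      (.add_right (tens_commute fun r => ?_) (tens_commute fun r => ?_))
    · cases r <;> simp [inputOps]
    · cases r <;> simp [inputOps]
    · by_cases hr : r = .data i
      · subst hr; simp [inputOps, Ry_commute]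
      · cases r <;> simp_all [inputOps]
  | ctrlRy i j hj =>
    refine ⟨-(j * Real.pi), ?_⟩
    rw [Step.op, controlled_eq_tens _ (by simp)]
    -- `R_y(π)` exchanges the two values of the control and `σ_z` inverts the rotation of the
    -- target, so the two branches of the gate are exchanged.
    rw [Matrix.mul_add, Matrix.mul_add, Matrix.add_mul, add_comm (_ * _)]
    simp only [tens_mul]
    congr 2 <;> funext r
    · by_cases hr : r = .data i
      · subst hr; simp [inputOps, Ry_pi]
      · cases r <;> simp_all [inputOps, sigmaZ_mul_Ry]
    · by_cases hr : r = .data i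
      · subst hr; simp [inputOps, Ry_pi]
      · cases r <;> simp_all [inputOps, ← Ry_add, Ry_zero]

lemma stepsOp_commute_phase {n m : ℕ} (l : List (Step n m)) (θ : ℝ) :
    Commute (tens (inputOps 1 (Ry θ))) (stepsOp l) := by
  induction l with
  | nil => exact .one_right _
  | cons s l ih => exact ih.mul_right (stepOp_commute_phase s θ)

lemma exists_stepsOp_flip {n m : ℕ} (l : List (Step n m)) :
    ∃ φ : ℝ, tens (inputOps (Ry Real.pi) sigmaZ) * stepsOp l =
      tens (inputOps 1 (Ry φ)) * stepsOp l * tens (inputOps (Ry Real.pi) sigmaZ) := by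
  induction l with
  | nil =>
    refine ⟨0, ?_⟩
    rw [← joint_inputOp 1, Ry_zero, inputOp_one, joint, Matrix.one_kronecker_one,
      Matrix.submatrix_one_equiv]
    simp [stepsOp]
  | cons s l ih =>
    obtain ⟨φ, hφ⟩ := ih
    obtain ⟨χ, hχ⟩ := exists_stepOp_flip s
    refine ⟨φ + χ, ?_⟩
    have h : tens (inputOps (n := n) (m := m) 1 (Ry (φ + χ))) =
        tens (inputOps 1 (Ry φ)) * tens (inputOps 1 (Ry χ)) := by
      rw [tens_mul]
      congr 1
      funext r
      cases r <;> simp [inputOps, Ry_add]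
    have hc := (stepsOp_commute_phase l χ).eq
    rw [stepsOp, ← mul_assoc, hφ, mul_assoc, hχ, h]
    simp only [mul_assoc]
    rw [← mul_assoc (stepsOp l), ← hc]
    simp only [mul_assoc]

lemma bobState_rotate_phase {n m : ℕ} (c : Circuit n m) (θ : ℝ)
    (σ : Matrix (Fin n → Fin 2) (Fin n → Fin 2) ℂ) (M : Matrix (Fin 2) (Fin 2) ℂ) :
    bobState c (σ ⊗ₖ (Ry θ * M * (Ry θ)ᴴ)) = bobState c (σ ⊗ₖ M) := by
  have hL : (inputOp n 1 (Ry θ))ᴴ * inputOp n 1 (Ry θ) = 1 := by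
    rw [conjTranspose_inputOp, inputOp_mul, conjTranspose_Ry_mul_self, Matrix.conjTranspose_one,
      mul_one, inputOp_one]
  rw [← bobState_conj c hL (K := inputOp n 1 (Ry θ)) _ (σ ⊗ₖ M)]
  · have h1 : tens (fun _ : Fin n => (1 : Matrix (Fin 2) (Fin 2) ℂ)) = 1 := tens_one
    rw [inputOp, h1, Matrix.conjTranspose_kronecker, ← Matrix.mul_kronecker_mul,
      ← Matrix.mul_kronecker_mul, Matrix.conjTranspose_one, one_mul, mul_one]
  · rw [joint_inputOp]
    exact (stepsOp_commute_phase _ _).eq.symm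

/-- Only the trace and the antisymmetric part of the phase qubit's factor reach Bob: these are
what is left of it after averaging over `1` and `R_y(π)`. -/
lemma bobState_congr_phase {n m : ℕ} (c : Circuit n m)
    (σ : Matrix (Fin n → Fin 2) (Fin n → Fin 2) ℂ) {M N : Matrix (Fin 2) (Fin 2) ℂ}
    (htr : M.trace = N.trace) (hanti : M - Mᵀ = N - Nᵀ) :
    bobState c (σ ⊗ₖ M) = bobState c (σ ⊗ₖ N) := by
  have twirl (M : Matrix (Fin 2) (Fin 2) ℂ) : (2 : ℂ) • bobState c (σ ⊗ₖ M) =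
      bobState c (σ ⊗ₖ (M + Ry Real.pi * M * (Ry Real.pi)ᴴ)) := by
    rw [Matrix.kronecker_add, bobState_add, bobState_rotate_phase, two_smul]
  have h : M + Ry Real.pi * M * (Ry Real.pi)ᴴ = N + Ry Real.pi * N * (Ry Real.pi)ᴴ := by
    have h01 := congrFun₂ hanti 0 1
    rw [Matrix.trace_fin_two, Matrix.trace_fin_two] at htr
    simp only [Matrix.sub_apply, Matrix.transpose_apply] at h01
    rw [Ry_pi_conj, Ry_pi_conj]
    ext i j
    fin_cases i <;> fin_cases j <;> simp
    · exact htr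
    · linear_combination h01
    · linear_combination -h01
    · linear_combination htr
  have h2 := (twirl M).trans ((congrArg (fun P => bobState c (σ ⊗ₖ P)) h).trans (twirl N).symm)
  exact smul_right_injective _ (two_ne_zero (α := ℂ)) h2

/-- The spin flip: with `R_y(π)` on every data qubit, transposing the phase qubit's factor goes
unnoticed by Bob. -/
lemma bobState_flip {n m : ℕ} (c : Circuit n m)
    (σ : Matrix (Fin n → Fin 2) (Fin n → Fin 2) ℂ) (M : Matrix (Fin 2) (Fin 2) ℂ) :
    bobState c ((tens (fun _ => Ry Real.pi) * σ * (tens fun _ => Ry Real.pi)ᴴ) ⊗ₖ Mᵀ) =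
      bobState c (σ ⊗ₖ M) := by
  have hZ : sigmaZᴴ * sigmaZ = 1 := by
    ext i j
    fin_cases i <;> fin_cases j <;> simp [sigmaZ, Matrix.mul_apply, Matrix.conjTranspose_apply]
  obtain ⟨φ, hφ⟩ := exists_stepsOp_flip c.steps
  have hL : (inputOp n (Ry Real.pi) (Ry (-φ) * sigmaZ))ᴴ *
      inputOp n (Ry Real.pi) (Ry (-φ) * sigmaZ) = 1 := by
    rw [conjTranspose_inputOp, inputOp_mul, conjTranspose_Ry_mul_self, Matrix.conjTranspose_mul,
      mul_assoc, ← mul_assoc (Ry (-φ))ᴴ, conjTranspose_Ry_mul_self, one_mul, hZ, inputOp_one]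
  rw [← bobState_conj c hL (K := inputOp n (Ry Real.pi) sigmaZ) _ (σ ⊗ₖ M)]
  · rw [inputOp, Matrix.conjTranspose_kronecker, ← Matrix.mul_kronecker_mul,
      ← Matrix.mul_kronecker_mul]
    rw [sigmaZ_conj]
    refine bobState_congr_phase c _ ?_ ?_
    · simp [Matrix.trace_fin_two]
    · ext i j
      fin_cases i <;> fin_cases j <;> simp <;> ring
  · have h1 : inputOp n (Ry Real.pi) (Ry (-φ) * sigmaZ) =
        inputOp n 1 (Ry (-φ)) * inputOp n (Ry Real.pi) sigmaZ := by
      rw [inputOp_mul, one_mul]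
    have h2 : joint (m := m) (inputOp n 1 (Ry (-φ))) 1 * joint (inputOp n 1 (Ry φ)) 1 = 1 := by
      rw [joint_mul, inputOp_mul, ← Ry_add, neg_add_cancel, Ry_zero, mul_one, inputOp_one, joint,
        mul_one, Matrix.one_kronecker_one, Matrix.submatrix_one_equiv]
    rw [← joint_inputOp, ← joint_inputOp] at hφ
    rw [h1, ← mul_one (1 : Matrix (BobReg m) (BobReg m) ℂ), ← joint_mul, mul_one, mul_assoc, hφ,
      ← mul_assoc, ← mul_assoc, h2, one_mul]

/-! ### Input states -/

lemma mask_eq_inputOp (n : ℕ) (θ : ℝ) : mask n θ = inputOp n (Ry Real.pi) (Ry θ) := rfl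

lemma transpose_of_mem_inputStates {n : ℕ} {ρ : Matrix (InReg n) (InReg n) ℂ}
    (hρ : ρ ∈ inputStates n) : ρᵀ = ρ := by
  refine convexHull_min (t := {ρ | ρᵀ = ρ}) ?_ ?_ hρ
  · rintro _ ⟨φ, -, rfl⟩
    ext x y
    simp only [pureState, rebitEncode, Matrix.transpose_apply, Matrix.vecMulVec_apply,
      Pi.star_apply]
    split_ifs <;> simp [mul_comm]
  · intro x hx y hy a b _ _ _
    simp only [Set.mem_ofPred_eq] at *
    rw [Matrix.transpose_add, Matrix.transpose_smul, Matrix.transpose_smul, hx, hy]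

lemma transpose_right_of_kronecker {n : ℕ} {σ : Matrix (Fin n → Fin 2) (Fin n → Fin 2) ℂ}
    {τ : Matrix (Fin 2) (Fin 2) ℂ} (hσ : σ.trace = 1) (h : (σ ⊗ₖ τ)ᵀ = σ ⊗ₖ τ) : τᵀ = τ := by
  ext i j
  have h1 (x : Fin n → Fin 2) : σ x x * τ j i = σ x x * τ i j := congrFun₂ h (x, i) (x, j)
  have h2 := Finset.sum_congr rfl fun x (_ : x ∈ Finset.univ) => h1 x
  rw [← Finset.sum_mul, ← Finset.sum_mul] at h2
  have h3 : ∑ x, σ x x = 1 := hσ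
  rw [h3, one_mul, one_mul] at h2
  exact h2

/-- The rebit encoding of the amplitude `α`, as a state of the phase qubit. -/
def rebit (α : ℂ) : Fin 2 → ℂ := ![(α.re : ℂ), (α.im : ℂ)]

lemma star_rebit (α : ℂ) : star (rebit α) = rebit α := by
  ext i; fin_cases i <;> simp [rebit]

lemma pureState_logicalKet {n : ℕ} (s : Fin n → Fin 2) (α β : ℂ) :
    pureState (rebitEncode (logicalKet s α β)) =
      Matrix.single s s 1 ⊗ₖ Matrix.vecMulVec (rebit α) (rebit α) +
      Matrix.single (s + 1) (s + 1) 1 ⊗ₖ Matrix.vecMulVec (rebit β) (rebit β) +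
      (Matrix.single s (s + 1) 1 ⊗ₖ Matrix.vecMulVec (rebit α) (rebit β) +
      Matrix.single (s + 1) s 1 ⊗ₖ Matrix.vecMulVec (rebit β) (rebit α)) := by
  have h : rebitEncode (logicalKet s α β) = fun x =>
      (Pi.single s 1 : (Fin n → Fin 2) → ℂ) x.1 * rebit α x.2 +
      (Pi.single (s + 1) 1 : (Fin n → Fin 2) → ℂ) x.1 * rebit β x.2 := by
    funext ⟨x, p⟩
    have hs : (fun i => s i + 1) = s + 1 := rfl
    simp only [rebitEncode, logicalKet, hs, Pi.add_apply, Pi.single_apply]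
    fin_cases p <;> simp [rebit] <;> split_ifs <;> simp
  ext ⟨x, p⟩ ⟨y, q⟩
  have hr (γ : ℂ) (p : Fin 2) : star (rebit γ p) = rebit γ p := congrFun (star_rebit γ) p
  have hp (a : Fin n → Fin 2) : star ((Pi.single a 1 : (Fin n → Fin 2) → ℂ) y) =
      (Pi.single a 1 : (Fin n → Fin 2) → ℂ) y := by
    rw [Pi.single_apply]; split_ifs <;> simp
  have hsg (a b : Fin n → Fin 2) : Matrix.single a b (1 : ℂ) x y =
      (Pi.single a 1 : (Fin n → Fin 2) → ℂ) x * (Pi.single b 1 : (Fin n → Fin 2) → ℂ) y := by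
    simp only [Matrix.single_apply, Pi.single_apply]
    by_cases h1 : a = x <;> by_cases h2 : b = y <;> simp [h1, h2, eq_comm (a := x),
      eq_comm (a := y)]
  simp only [pureState, h, Matrix.add_apply, Matrix.kroneckerMap_apply, Matrix.vecMulVec_apply,
    Pi.star_apply, star_add, star_mul', hr, hp, hsg]
  ring

lemma flip_single_apply {n : ℕ} (a b x y : Fin n → Fin 2) :
    (tens (fun _ => Ry Real.pi) * Matrix.single a b (1 : ℂ) * (tens fun _ => Ry Real.pi)ᴴ :
      Matrix (Fin n → Fin 2) (Fin n → Fin 2) ℂ) x y =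
      ∏ i, Ry Real.pi (x i) (a i) * star (Ry Real.pi (y i) (b i)) := by
  rw [Finset.prod_mul_distrib, ← star_prod, ← tens_apply, ← tens_apply]
  simp [Matrix.mul_apply, Matrix.single_apply, ite_and, Finset.sum_ite_eq]

lemma flip_single_self {n : ℕ} (s : Fin n → Fin 2) :
    tens (fun _ => Ry Real.pi) * Matrix.single s s (1 : ℂ) * (tens fun _ => Ry Real.pi)ᴴ =
      Matrix.single (s + 1) (s + 1) 1 := by
  have key (a x y : Fin 2) : Ry Real.pi x a * star (Ry Real.pi y a) =
      if a + 1 = x ∧ a + 1 = y then 1 else 0 := by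
    rw [Ry_pi]
    fin_cases a <;> fin_cases x <;> fin_cases y <;> simp
  ext x y
  simp only [flip_single_apply, key, Finset.prod_ite_zero, Matrix.single_apply, funext_iff]
  simp [forall_and]

/-- `R_y(π)` has the square `-1`, hence the sign for an odd number of qubits. -/
lemma flip_single_compl {n : ℕ} (hn : Odd n) (s : Fin n → Fin 2) :
    tens (fun _ => Ry Real.pi) * Matrix.single s (s + 1) (1 : ℂ) *
      (tens fun _ => Ry Real.pi)ᴴ = -Matrix.single (s + 1) s 1 := by
  have key (a x y : Fin 2) : Ry Real.pi x a * star (Ry Real.pi y (a + 1)) =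
      if a + 1 = x ∧ a = y then -1 else 0 := by
    rw [Ry_pi]
    fin_cases a <;> fin_cases x <;> fin_cases y <;> simp
  ext x y
  simp only [flip_single_apply, Pi.add_apply, Pi.one_apply, key, Finset.prod_ite_zero,
    Matrix.neg_apply, Matrix.single_apply, funext_iff]
  simp [forall_and, hn.neg_one_pow, apply_ite]

lemma bobState_logical {n m : ℕ} (c : Circuit n m) (hn : Odd n) (s : Fin n → Fin 2)
    {ρ : Matrix (InReg n) (InReg n) ℂ} (hρ : ρ ∈ logicalStates s) :
    bobState c ρ = bobState c (Matrix.single s s 1 ⊗ₖ Matrix.single 0 0 1) := by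
  set ρ₀ := bobState c (Matrix.single s s 1 ⊗ₖ Matrix.single 0 0 1)
  refine convexHull_min (t := {ρ | bobState c ρ = ρ₀}) ?_ ?_ hρ
  · rintro _ ⟨α, β, h, rfl⟩
    have hdiag (γ : ℂ) : bobState c (Matrix.single s s 1 ⊗ₖ Matrix.vecMulVec (rebit γ) (rebit γ)) =
        ((‖γ‖ ^ 2 : ℝ) : ℂ) • ρ₀ := by
      rw [← bobState_smul, ← Matrix.kronecker_smul]
      refine bobState_congr_phase c _ ?_ ?_
      · rw [← Complex.normSq_eq_norm_sq, Complex.normSq_apply]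
        simp [Matrix.trace_fin_two, rebit]
      · rw [Matrix.transpose_vecMulVec, Matrix.transpose_smul, Matrix.transpose_single,
          sub_self, sub_self]
    rw [Set.mem_ofPred_eq, pureState_logicalKet, bobState_add, bobState_add, bobState_add, hdiag,
      ← flip_single_self s]
    nth_rewrite 1 [← Matrix.transpose_vecMulVec (rebit β) (rebit β)]
    -- The two off-diagonal terms are minus the spin flips of each other.
    have hcross : bobState c (Matrix.single s (s + 1) 1 ⊗ₖ
        Matrix.vecMulVec (rebit α) (rebit β)) = -bobState c (Matrix.single (s + 1) s 1 ⊗ₖ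
        Matrix.vecMulVec (rebit β) (rebit α)) := by
      rw [← bobState_flip, flip_single_compl hn, Matrix.transpose_vecMulVec, ← bobState_neg]
      congr 1
      ext x y
      simp [Matrix.kroneckerMap_apply]
    rw [bobState_flip, hdiag, hcross, neg_add_cancel, add_zero, ← add_smul, ← Complex.ofReal_add,
      h, Complex.ofReal_one, one_smul]
  · intro x hx y hy a b _ _ hab
    simp only [Set.mem_ofPred_eq] at *
    have h (a : ℝ) (x : Matrix (InReg n) (InReg n) ℂ) : a • x = (a : ℂ) • x := by
      ext; simp
    rw [h, h, bobState_add, bobState_smul, bobState_smul, hx, hy, ← add_smul,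
      ← Complex.ofReal_add, hab, Complex.ofReal_one, one_smul]

lemma BobCannotDistinguish.of_bobState_eq {n m : ℕ} {c : Circuit n m}
    {ρ₁ ρ₂ : Matrix (InReg n) (InReg n) ℂ} (h : bobState c ρ₁ = bobState c ρ₂) :
    BobCannotDistinguish c ρ₁ ρ₂ := fun _ _ _ _ => by rw [h]

end RebitQHE

end

theorem theorem2 (n m : ℕ) (c : RebitQHE.Circuit n m) :
    (∀ (ρ₁ ρ₂ : Matrix (RebitQHE.InReg n) (RebitQHE.InReg n) ℂ) (θ : ℝ),
      ρ₁ ∈ RebitQHE.inputStates n → RebitQHE.IsProductState ρ₁ →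
      ρ₂ = RebitQHE.mask n θ * ρ₁ * (RebitQHE.mask n θ)ᴴ →
      RebitQHE.BobCannotDistinguish c ρ₁ ρ₂) ∧
    (Odd n → ∀ s : Fin n → Fin 2,
      ∀ ρ₁ ∈ RebitQHE.logicalStates s, ∀ ρ₂ ∈ RebitQHE.logicalStates s,
        RebitQHE.BobCannotDistinguish c ρ₁ ρ₂) := by
  constructor
  · rintro _ _ θ hρ ⟨σ, τ, hσ, -, rfl⟩ rfl
    have hτ := RebitQHE.transpose_right_of_kronecker hσ.2
      (RebitQHE.transpose_of_mem_inputStates hρ)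
    refine .of_bobState_eq ?_
    rw [RebitQHE.mask_eq_inputOp, RebitQHE.inputOp, Matrix.conjTranspose_kronecker,
      ← Matrix.mul_kronecker_mul, ← Matrix.mul_kronecker_mul, RebitQHE.bobState_rotate_phase,
      ← RebitQHE.bobState_flip, hτ]
  · intro hn s ρ₁ h₁ ρ₂ h₂
    exact .of_bobState_eq
      ((RebitQHE.bobState_logical c hn s h₁).trans (RebitQHE.bobState_logical c hn s h₂).symm)
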